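/- Let $D\ge 1$ and let $X_1,\dots,X_D$ be geodesic $\delta$-hyperbolic metric spaces, with Gromov boundaries $\partial X_i$. Let $\mathbb X=\prod_{i=1}^D X_i$ with the $\ell^\infty$ product metric, let $\partial_{reg}\mathbb X=\prod_{i=1}^D\partial X_i$, and let $\mathrm{Aut}\,\mathbb X$ be the group of isometries of $\mathbb X$ generated by $\prod_{i=1}^D\mathrm{Isom}\,X_i$ and the permutations of isometric factors, i.e. the group of all maps $(x_j)_j\mapsto(\varphi_j(x_{\sigma(j)}))_j$ with $\sigma$ a permutation of $\{1,\dots,D\}$ and $\varphi_j\colon X_{\sigma(j)}\to X_j$ surjective isometries; it acts on $\partial_{reg}\mathbb X$ by the same formula. Let $\Gamma$ be a group and $\Gamma\to\mathrm{Aut}\,\mathbb X$ a homomorphism which is AU-acylindrical (acylindrical of ambiguous uniformity): for every $\epsilon>0$ there is $R\ge 0$ such that for all $x,y\in\mathbb X$ with $d(x,y)\ge R$ the set $\{g\in\Gamma : d(gx,x)\le\epsilon \text{ and } d(gy,y)\le\epsilon\}$ is finite. Let $\xi^-,\xi^+\in\partial_{reg}\mathbb X$ have distinct factors, i.e. $\xi^-_i\ne\xi^+_i$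 for every $i\in\{1,\dots,D\}$. Then there is an integer $k$ with $0\le k\le D$ such that the stabilizer $$E_\Gamma(\xi^\pm)=\mathrm{Stab}_\Gamma\{\xi^-,\xi^+\}=\{g\in\Gamma : g\{\xi^-,\xi^+\}=\{\xi^-,\xi^+\}\}$$ is virtually isomorphic to $\mathbb Z^k$. Here groups $G$ and $H$ are virtually isomorphic if there are finite index subgroups $G'\le G$, $H'\le H$ and finite normal subgroups $K\trianglelefteq G'$, $L\trianglelefteq H'$ such that $G'/K\cong H'/L$. -/

import Mathlib

open Filter
open scoped Pointwise

namespace HypProd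

universe u v

noncomputable section

/-! ### Geodesic hyperbolic spaces -/

/-- The Gromov product `⟨x, y⟩_o`. -/
def gromovProduct {X : Type u} [MetricSpace X] (x y o : X) : ℝ :=
  (dist x o + dist o y - dist x y) / 2

/-- `γ`, restricted to `[0, dist a b]`, is a geodesic segment from `a` to `b`. -/
def IsGeodesicSegment {X : Type u} [MetricSpace X] (γ : ℝ → X) (a b : X) : Prop :=
  γ 0 = a ∧ γ (dist a b) = b ∧
    ∀ s ∈ Set.Icc 0 (dist a b), ∀ t ∈ Set.Icc 0 (dist a b), dist (γ s) (γ t) = |s - t|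

/-- Any two points are joined by a geodesic segment. -/
def IsGeodesicSpace (X : Type u) [MetricSpace X] : Prop :=
  ∀ a b : X, ∃ γ : ℝ → X, IsGeodesicSegment γ a b

/-- Geodesic triangles are `δ`-thin: for the projection of a geodesic triangle with vertices
`a, b, c` to its comparison tripod, all fibres have diameter at most `δ`.
The leg of the tripod at the vertex `a` has length `⟨b, c⟩_a`, and two points on different sides
of the triangle have the same image iff, for the vertex `a` common to the two sides, they are at
the same distance `t ≤ ⟨b, c⟩_a` from `a` (the centre of the tripod being the case
`t = ⟨b, c⟩_a`). All the vertices are covered since `a, b, c` are arbitrary. -/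
def HasThinTriangles (δ : ℝ) (X : Type u) [MetricSpace X] : Prop :=
  ∀ (a b c : X) (γ γ' : ℝ → X), IsGeodesicSegment γ a b → IsGeodesicSegment γ' a c →
    ∀ t : ℝ, 0 ≤ t → t ≤ gromovProduct b c a → dist (γ t) (γ' t) ≤ δ

/-- `X` is a `δ`-hyperbolic geodesic space. -/
def IsHyperbolic (δ : ℝ) (X : Type u) [MetricSpace X] : Prop :=
  IsGeodesicSpace X ∧ HasThinTriangles δ X

/-! ### The Gromov boundary -/

/-- The Gromov products `⟨x(n), y(m)⟩_o` tend to infinity as `n, m → ∞` (for every base point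
`o`, equivalently for one base point). -/
def GromovConv {X : Type u} [MetricSpace X] (x y : ℕ → X) : Prop :=
  ∀ o : X, Tendsto (fun p : ℕ × ℕ => gromovProduct (x p.1) (y p.2) o) atTop atTop

/-- Gromov sequences in `X`. -/
def GromovSeq (X : Type u) [MetricSpace X] : Type u :=
  {x : ℕ → X // GromovConv x x}

/-- Equivalence of Gromov sequences. -/
def GromovSeq.Equivalent {X : Type u} [MetricSpace X] (x y : GromovSeq X) : Prop :=
  GromovConv x.1 y.1

/-- The Gromov boundary: Gromov sequences up to equivalence. On a hyperbolic space equivalence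
is an equivalence relation, see `GromovBoundary.mk_eq_mk_iff`. -/
def GromovBoundary (X : Type u) [MetricSpace X] : Type u :=
  Quot (GromovSeq.Equivalent (X := X))

theorem gromovProduct_comm {X : Type u} [MetricSpace X] (x y o : X) :
    gromovProduct x y o = gromovProduct y x o := by
  unfold gromovProduct
  rw [dist_comm x y, dist_comm x o, dist_comm o y]
  ring

theorem gromovProduct_le_left {X : Type u} [MetricSpace X] (x y o : X) :
    gromovProduct x y o ≤ dist o x := by
  have := dist_triangle o x y
  have := dist_comm x o
  unfold gromovProduct
  linarith

theorem gromovProduct_nonneg {X : Type u} [MetricSpace X] (x y o : X) :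
    0 ≤ gromovProduct x y o := by
  have := dist_triangle x o y
  unfold gromovProduct
  linarith

/-- The four-point inequality in a hyperbolic geodesic space. -/
theorem IsHyperbolic.four_point {X : Type u} [MetricSpace X] {δ : ℝ} (h : IsHyperbolic δ X)
    (x y z o : X) :
    min (gromovProduct x y o) (gromovProduct y z o) - δ ≤ gromovProduct x z o := by
  obtain ⟨γx, hx⟩ := h.1 o x
  obtain ⟨γy, hy⟩ := h.1 o y
  obtain ⟨γz, hz⟩ := h.1 o z
  set t := min (gromovProduct x y o) (gromovProduct y z o) with ht
  have t0 : 0 ≤ t := le_min (gromovProduct_nonneg _ _ _) (gromovProduct_nonneg _ _ _)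
  have t1 : t ≤ gromovProduct x y o := min_le_left _ _
  have t2 : t ≤ gromovProduct y z o := min_le_right _ _
  have tx : t ≤ dist o x := t1.trans (gromovProduct_le_left _ _ _)
  have tz : t ≤ dist o z := by
    rw [gromovProduct_comm] at t2
    exact t2.trans (gromovProduct_le_left _ _ _)
  have h1 := h.2 o x y γx γy hx hy t t0 t1
  have h2 := h.2 o y z γy γz hy hz t t0 t2
  have e1 := hx.2.2 (dist o x) ⟨dist_nonneg, le_rfl⟩ t ⟨t0, tx⟩
  have e2 := hz.2.2 t ⟨t0, tz⟩ (dist o z) ⟨dist_nonneg, le_rfl⟩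
  rw [hx.2.1, abs_of_nonneg (by linarith)] at e1
  rw [hz.2.1, abs_of_nonpos (by linarith)] at e2
  have := dist_triangle4 x (γx t) (γz t) z
  have := dist_triangle (γx t) (γy t) (γz t)
  have := dist_comm x o
  unfold gromovProduct
  linarith

theorem gromovConv_iff {X : Type u} [MetricSpace X] {x y : ℕ → X} :
    GromovConv x y ↔ ∀ (o : X) (C : ℝ), ∃ N : ℕ, ∀ n ≥ N, ∀ m ≥ N,
      C ≤ gromovProduct (x n) (y m) o := by
  unfold GromovConv
  refine forall_congr' fun o => ?_
  rw [tendsto_atTop_atTop]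
  refine forall_congr' fun C => ⟨?_, ?_⟩
  · rintro ⟨⟨a, b⟩, hab⟩
    exact ⟨max a b, fun n hn m hm =>
      hab (n, m) ⟨(le_max_left _ _).trans hn, (le_max_right _ _).trans hm⟩⟩
  · rintro ⟨N, hN⟩
    exact ⟨(N, N), fun p hp => hN p.1 hp.1 p.2 hp.2⟩

theorem GromovSeq.Equivalent.equivalence {X : Type u} [MetricSpace X] {δ : ℝ}
    (h : IsHyperbolic δ X) : Equivalence (GromovSeq.Equivalent (X := X)) where
  refl x := x.2
  symm := by
    intro x y hxy
    refine gromovConv_iff.2 fun o C => ?_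
    obtain ⟨N, hN⟩ := gromovConv_iff.1 hxy o C
    refine ⟨N, fun n hn m hm => ?_⟩
    rw [gromovProduct_comm]
    exact hN m hm n hn
  trans := by
    intro x y z hxy hyz
    refine gromovConv_iff.2 fun o C => ?_
    obtain ⟨N, hN⟩ := gromovConv_iff.1 hxy o (C + δ)
    obtain ⟨M, hM⟩ := gromovConv_iff.1 hyz o (C + δ)
    refine ⟨max N M, fun n hn m hm => ?_⟩
    have h1 := hN n ((le_max_left _ _).trans hn) (max N M) (le_max_left _ _)
    have h2 := hM (max N M) (le_max_right _ _) m ((le_max_right _ _).trans hm)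
    have := h.four_point (x.1 n) (y.1 (max N M)) (z.1 m) o
    have := le_min h1 h2
    linarith

/-- In a hyperbolic space, two Gromov sequences define the same boundary point iff they are
equivalent. -/
theorem GromovBoundary.mk_eq_mk_iff {X : Type u} [MetricSpace X] {δ : ℝ}
    (h : IsHyperbolic δ X) (x y : GromovSeq X) :
    (Quot.mk _ x : GromovBoundary X) = Quot.mk _ y ↔ x.Equivalent y :=
  (GromovSeq.Equivalent.equivalence h).quot_mk_eq_iff x y

theorem GromovConv.map {X Y : Type u} [MetricSpace X] [MetricSpace Y] (e : X ≃ᵢ Y)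
    {x y : ℕ → X} (h : GromovConv x y) :
    GromovConv (fun n => e (x n)) (fun n => e (y n)) := by
  intro o
  have := h (e.symm o)
  refine this.congr fun p => ?_
  unfold gromovProduct
  rw [← e.dist_eq (x p.1) (e.symm o), ← e.dist_eq (e.symm o), ← e.dist_eq (x p.1) (y p.2),
    e.apply_symm_apply]

/-- The image of a Gromov sequence under an isometry. -/
def GromovSeq.map {X Y : Type u} [MetricSpace X] [MetricSpace Y] (e : X ≃ᵢ Y)
    (x : GromovSeq X) : GromovSeq Y :=
  ⟨fun n => e (x.1 n), x.2.map e⟩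

/-- The map of Gromov boundaries induced by an isometry. -/
def GromovBoundary.map {X Y : Type u} [MetricSpace X] [MetricSpace Y] (e : X ≃ᵢ Y) :
    GromovBoundary X → GromovBoundary Y :=
  Quot.map (GromovSeq.map e) fun _ _ h => GromovConv.map e h

/-! ### Automorphisms of a product -/

/-- The isometry `X i ≃ᵢ X j` given by an equality of indices. -/
def castIso {D : ℕ} (X : Fin D → Type u) [∀ i, MetricSpace (X i)] {i j : Fin D} (h : i = j) :
    X i ≃ᵢ X j := by
  subst h
  exact IsometryEquiv.refl _

theorem castIso_heq {D : ℕ} (X : Fin D → Type u) [∀ i, MetricSpace (X i)] {i j : Fin D}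
    (h : i = j) : HEq (castIso X h) (IsometryEquiv.refl (X j)) := by
  subst h
  rfl

/-- `Aut 𝕏` for `𝕏 = ∏ X_i`: a permutation of the indices (only matching isometric factors)
together with isometries between the matched factors. An element `g` acts on `𝕏` by
`(g x)_j = g.iso j (x_{g.perm j})`. -/
structure ProdAut {D : ℕ} (X : Fin D → Type u) [∀ i, MetricSpace (X i)] where
  /-- the factor `X (perm j)` is carried to the factor `X j` -/
  perm : Equiv.Perm (Fin D)
  /-- the isometry from the factor `X (perm j)` onto the factor `X j` -/
  iso : ∀ j, X (perm j) ≃ᵢ X j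

namespace ProdAut

variable {D : ℕ} {X : Fin D → Type u} [∀ i, MetricSpace (X i)]

theorem ext_heq {g h : ProdAut X} (h1 : g.perm = h.perm) (h2 : ∀ j, HEq (g.iso j) (h.iso j)) :
    g = h := by
  obtain ⟨σ, φ⟩ := g
  obtain ⟨τ, ψ⟩ := h
  obtain rfl : σ = τ := h1
  obtain rfl : φ = ψ := funext fun j => eq_of_heq (h2 j)
  rfl

instance : One (ProdAut X) := ⟨⟨1, fun j => IsometryEquiv.refl (X j)⟩⟩

/-- Composition of the actions on `∏ X_i`: first `h`, then `g`. -/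
instance : Mul (ProdAut X) :=
  ⟨fun g h => ⟨g.perm.trans h.perm, fun j => (h.iso (g.perm j)).trans (g.iso j)⟩⟩

instance : Inv (ProdAut X) :=
  ⟨fun g => ⟨g.perm.symm, fun j =>
    (g.iso (g.perm.symm j)).symm.trans (castIso X (g.perm.apply_symm_apply j))⟩⟩

instance : Group (ProdAut X) :=
  Group.ofLeftAxioms (fun _ _ _ => rfl) (fun _ => rfl) (by
    intro g
    refine ext_heq (Equiv.symm_trans_self g.perm) fun j => ?_
    refine HEq.trans (heq_of_eq ?_) (castIso_heq X (g.perm.apply_symm_apply j))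
    ext x
    exact congrArg (castIso X (g.perm.apply_symm_apply j))
      ((g.iso (g.perm.symm j)).symm_apply_apply x))

/-- The action of `Aut 𝕏` on the product `𝕏 = ∏ X_i`. -/
instance : MulAction (ProdAut X) (∀ i, X i) where
  smul g x := fun j => g.iso j (x (g.perm j))
  one_smul _ := rfl
  mul_smul _ _ _ := rfl

end ProdAut

/-- The regular boundary `∂_reg 𝕏 = ∏ ∂X_i`. -/
def RegBoundary {D : ℕ} (X : Fin D → Type u) [∀ i, MetricSpace (X i)] : Type u :=
  ∀ i, GromovBoundary (X i)

/-- The action of `Aut 𝕏` on the regular boundary: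
`(g ξ)_j = g.iso j (ξ_{g.perm j})`. -/
instance {D : ℕ} (X : Fin D → Type u) [∀ i, MetricSpace (X i)] :
    MulAction (ProdAut X) (RegBoundary X) where
  smul g ξ := fun j => GromovBoundary.map (g.iso j) (ξ (g.perm j))
  one_smul ξ := by
    funext j
    change GromovBoundary.map (IsometryEquiv.refl (X j)) (ξ j) = ξ j
    induction ξ j using Quot.ind with
    | mk x => rfl
  mul_smul g h ξ := by
    funext j
    change GromovBoundary.map ((h.iso (g.perm j)).trans (g.iso j)) (ξ (h.perm (g.perm j))) =
      GromovBoundary.map (g.iso j)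
        (GromovBoundary.map (h.iso (g.perm j)) (ξ (h.perm (g.perm j))))
    induction ξ (h.perm (g.perm j)) using Quot.ind with
    | mk x => rfl

/-! ### AU-acylindrical actions -/

/-- `Aut 𝕏` acts on `𝕏` by isometries, for the `ℓ^∞` product metric (the metric of
`∀ i, X i`). -/
instance {D : ℕ} (X : Fin D → Type u) [∀ i, MetricSpace (X i)] :
    IsIsometricSMul (ProdAut X) (∀ i, X i) where
  isometry_smul g := by
    refine Isometry.of_dist_eq fun x y => ?_
    have key : ∀ r : ℝ, 0 ≤ r → (dist (g • x) (g • y) ≤ r ↔ dist x y ≤ r) := by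
      intro r hr
      rw [dist_pi_le_iff hr, dist_pi_le_iff hr]
      constructor
      · intro h i
        have := h (g.perm.symm i)
        change dist (g.iso _ (x (g.perm _))) (g.iso _ (y (g.perm _))) ≤ r at this
        rwa [IsometryEquiv.dist_eq, Equiv.apply_symm_apply] at this
      · intro h j
        change dist (g.iso _ (x (g.perm _))) (g.iso _ (y (g.perm _))) ≤ r
        rw [IsometryEquiv.dist_eq]
        exact h _
    exact le_antisymm ((key _ dist_nonneg).2 le_rfl) ((key _ dist_nonneg).1 le_rfl)

/-- The homomorphism from a group acting by isometries to the isometry group. -/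
def toIsom (G : Type v) (Y : Type u) [Group G] [MetricSpace Y] [MulAction G Y]
    [IsIsometricSMul G Y] : G →* (Y ≃ᵢ Y) where
  toFun g := IsometryEquiv.constSMul g
  map_one' := by
    ext y
    exact one_smul G y
  map_mul' g h := by
    ext y
    exact mul_smul g h y

/-- The `ε`-coarse stabilizer of a set `S`. -/
def coarseStab {Γ : Type v} {Y : Type u} [Group Γ] [MetricSpace Y] (ρ : Γ →* (Y ≃ᵢ Y))
    (ε : ℝ) (S : Set Y) : Set Γ :=
  {g | ∀ x ∈ S, dist (ρ g x) x ≤ ε}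

/-- AU-acylindrical isometric actions (acylindrical of ambiguous uniformity). -/
def IsAUAcylindrical {Γ : Type v} {Y : Type u} [Group Γ] [MetricSpace Y]
    (ρ : Γ →* (Y ≃ᵢ Y)) : Prop :=
  ∀ ε : ℝ, 0 < ε → ∃ R : ℝ, 0 ≤ R ∧
    ∀ x y : Y, R ≤ dist x y → (coarseStab ρ ε {x, y}).Finite

/-! ### Virtual isomorphism -/

/-- `G` and `H` are virtually isomorphic: after passing to finite index subgroups and dividing
these by finite normal subgroups, they become isomorphic. -/
def VirtuallyIsomorphic (G : Type u) (H : Type v) [Group G] [Group H] : Prop :=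
  ∃ (G' : Subgroup G) (H' : Subgroup H), G'.FiniteIndex ∧ H'.FiniteIndex ∧
    ∃ (K : Subgroup G') (L : Subgroup H') (_ : K.Normal) (_ : L.Normal),
      Finite K ∧ Finite L ∧ Nonempty (G' ⧸ K ≃* H' ⧸ L)

end

end HypProd

/-! Fix endpoints `ξ ≠ η` in the boundary of one hyperbolic factor. The Busemann cocycle at `ξ`
turns the isometries fixing both ends into a group with a real quasimorphism, and the value of this
quasimorphism controls how far the isometry moves any point on the line between the ends. On a
finite index subgroup of the stabilizer, which fixes both points of the regular boundary and
permutes no factors, the `D` quasimorphisms together form a quasimorphism to `ℝ^D`, and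
acylindricity along the product of the lines says precisely that it is proper. Commutators are
bounded under a quasimorphism, so there are finitely many of them, and by a theorem of Schur and
Neumann the commutator subgroup is finite. Hence the homogenization of the quasimorphism is a
homomorphism to `ℝ^D`, with finite kernel and discrete image. -/

namespace HypProd

universe u v w

section Quasimorphism

open scoped commutatorElement

variable {G : Type u} [Group G] {E : Type w}

/-- The map `f` is a quasimorphism of defect at most `C`. -/
def IsQuasimorphism [SeminormedAddCommGroup E] (f : G → E) (C : ℝ) : Prop :=
  ∀ g h, ‖f (g * h) - f g - f h‖ ≤ C

/-- The homogenization `g ↦ lim f (g ^ n) / n` of a quasimorphism. The limit is taken along the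
powers of two only, where the sequence is geometrically Cauchy. -/
noncomputable def homogenization [NormedAddCommGroup E] [NormedSpace ℝ E] (f : G → E)
    (g : G) : E :=
  limUnder atTop fun n : ℕ => ((2 : ℝ) ^ n)⁻¹ • f (g ^ 2 ^ n)

namespace IsQuasimorphism

section Seminormed

variable [SeminormedAddCommGroup E] {f : G → E} {B C : ℝ}

theorem comp {H : Type v} [Group H] (hf : IsQuasimorphism f C) (φ : H →* G) :
    IsQuasimorphism (f ∘ φ) C := fun g h => by
  simpa only [Function.comp_apply, map_mul] using hf (φ g) (φ h)

theorem pi {ι : Type v} [Fintype ι] [Nonempty ι] {F : ι → Type w}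
    [∀ i, SeminormedAddCommGroup (F i)] {f : ∀ i, G → F i} (hf : ∀ i, IsQuasimorphism (f i) C) :
    IsQuasimorphism (fun g i => f i g) C := fun g h =>
  (pi_norm_le_iff_of_nonempty _).2 fun i => hf i g h

theorem norm_commutatorElement_le (hf : IsQuasimorphism f C) (g h : G) : ‖f ⁅g, h⁆‖ ≤ 3 * C := by
  have hcomm := hf ⁅g, h⁆ (h * g)
  rw [commutatorElement_def, show g * h * g⁻¹ * h⁻¹ * (h * g) = g * h by group] at hcomm
  calc ‖f ⁅g, h⁆‖ = ‖(f (g * h) - f g - f h) - (f (h * g) - f h - f g)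
        - (f (g * h) - f ⁅g, h⁆ - f (h * g))‖ := by congr 1; abel
    _ ≤ C + C + C := norm_sub_le_of_le (norm_sub_le_of_le (hf g h) (hf h g)) hcomm
    _ = 3 * C := by ring

theorem finite_commutator (hf : IsQuasimorphism f C)
    (hfin : ∀ B : ℝ, {g | ‖f g‖ ≤ B}.Finite) : Finite (commutator G) := by
  have : Finite (commutatorSet G) := by
    refine ((hfin (3 * C)).subset ?_).to_subtype
    rintro _ ⟨g, h, rfl⟩
    exact hf.norm_commutatorElement_le g h
  infer_instance

theorem norm_mul_pow_sub_le (hf : IsQuasimorphism f C) (hB : ∀ c ∈ commutator G, ‖f c‖ ≤ B)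
    (g h : G) (n : ℕ) : ‖f ((g * h) ^ n) - f (g ^ n) - f (h ^ n)‖ ≤ B + 2 * C := by
  obtain ⟨c, hc, hgh⟩ : ∃ c ∈ commutator G, g ^ n * h ^ n * c = (g * h) ^ n := by
    refine ⟨(g ^ n * h ^ n)⁻¹ * (g * h) ^ n, ?_, mul_inv_cancel_left _ _⟩
    rw [← Abelianization.ker_of, MonoidHom.mem_ker]
    simp only [map_mul, map_inv, map_pow, mul_pow, inv_mul_cancel]
  calc ‖f ((g * h) ^ n) - f (g ^ n) - f (h ^ n)‖
      = ‖f c + (f (g ^ n * h ^ n * c) - f (g ^ n * h ^ n) - f c)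
        + (f (g ^ n * h ^ n) - f (g ^ n) - f (h ^ n))‖ := by rw [hgh]; congr 1; abel
    _ ≤ B + C + C := norm_add_le_of_le (norm_add_le_of_le (hB c hc) (hf _ _)) (hf _ _)
    _ = B + 2 * C := by ring

end Seminormed

section Homogenization

variable [NormedAddCommGroup E] [NormedSpace ℝ E] {f : G → E} {B C : ℝ}

theorem dist_inv_two_pow_smul_le (hf : IsQuasimorphism f C) (g : G) (n : ℕ) :
    dist (((2 : ℝ) ^ n)⁻¹ • f (g ^ 2 ^ n)) (((2 : ℝ) ^ (n + 1))⁻¹ • f (g ^ 2 ^ (n + 1)))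
      ≤ C / 2 / 2 ^ n := by
  have hdouble := hf (g ^ 2 ^ n) (g ^ 2 ^ n)
  rw [← pow_add, ← mul_two, ← pow_succ, sub_sub, ← two_smul ℝ] at hdouble
  calc dist (((2 : ℝ) ^ n)⁻¹ • f (g ^ 2 ^ n)) (((2 : ℝ) ^ (n + 1))⁻¹ • f (g ^ 2 ^ (n + 1)))
      = ‖((2 : ℝ) ^ (n + 1))⁻¹ • (f (g ^ 2 ^ (n + 1)) - (2 : ℝ) • f (g ^ 2 ^ n))‖ := by
        rw [dist_eq_norm', smul_sub, smul_smul, pow_succ, mul_inv,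
          inv_mul_cancel_right₀ two_ne_zero]
    _ ≤ ((2 : ℝ) ^ (n + 1))⁻¹ * C := by
        rw [norm_smul, norm_inv, norm_pow, Real.norm_two]
        gcongr
    _ = C / 2 / 2 ^ n := by rw [pow_succ]; field_simp

variable [CompleteSpace E]

theorem tendsto_homogenization (hf : IsQuasimorphism f C) (g : G) :
    Tendsto (fun n : ℕ => ((2 : ℝ) ^ n)⁻¹ • f (g ^ 2 ^ n)) atTop (nhds (homogenization f g)) :=
  (cauchySeq_of_le_geometric_two (hf.dist_inv_two_pow_smul_le g)).tendsto_limUnder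

theorem norm_homogenization_sub_le (hf : IsQuasimorphism f C) (g : G) :
    ‖homogenization f g - f g‖ ≤ C := by
  simpa [dist_eq_norm'] using dist_le_of_le_geometric_two_of_tendsto₀
    (hf.dist_inv_two_pow_smul_le g) (hf.tendsto_homogenization g)

theorem homogenization_mul (hf : IsQuasimorphism f C) (hB : ∀ c ∈ commutator G, ‖f c‖ ≤ B)
    (g h : G) : homogenization f (g * h) = homogenization f g + homogenization f h := by
  have hlim := ((hf.tendsto_homogenization (g * h)).sub (hf.tendsto_homogenization g)).sub
    (hf.tendsto_homogenization h)
  have hzero : Tendsto (fun n : ℕ => ((2 : ℝ) ^ n)⁻¹ * (B + 2 * C)) atTop (nhds 0) := by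
    simpa using (tendsto_inv_atTop_zero.comp
      (tendsto_pow_atTop_atTop_of_one_lt (one_lt_two (α := ℝ)))).mul_const (B + 2 * C)
  rw [← sub_eq_zero, ← sub_sub]
  refine tendsto_nhds_unique hlim (squeeze_zero_norm (fun n => ?_) hzero)
  rw [← smul_sub, ← smul_sub, norm_smul, norm_inv, norm_pow, Real.norm_two]
  gcongr
  exact hf.norm_mul_pow_sub_le hB g h _

theorem exists_addMonoidHom (hf : IsQuasimorphism f C) (hB : ∀ c ∈ commutator G, ‖f c‖ ≤ B) :
    ∃ φ : Additive G →+ E, ∀ g, ‖φ (.ofMul g) - f g‖ ≤ C :=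
  ⟨.mk' (homogenization f ·.toMul) fun g h => hf.homogenization_mul hB g.toMul h.toMul,
    hf.norm_homogenization_sub_le⟩

end Homogenization

end IsQuasimorphism

theorem discreteTopology_of_finite_inter_ball [NormedAddCommGroup E] {L : AddSubgroup E}
    {r : ℝ} (hr : 0 < r) (hL : ((L : Set E) ∩ Metric.ball 0 r).Finite) : DiscreteTopology L :=
  discreteTopology_of_isOpen_singleton_zero <| isOpen_singleton_of_finite_mem_nhds 0
    (continuous_subtype_val.continuousAt.preimage_mem_nhds (Metric.ball_mem_nhds 0 hr))
    ((hL.preimage Subtype.val_injective.injOn).subset fun z hz => ⟨z.2, hz⟩)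

theorem exists_addEquiv_int_of_discreteTopology [NormedAddCommGroup E] [NormedSpace ℝ E]
    [FiniteDimensional ℝ E] (L : AddSubgroup E) [DiscreteTopology L] :
    ∃ k ≤ Module.finrank ℝ E, Nonempty (L ≃+ (Fin k → ℤ)) := by
  let M := AddSubgroup.toIntSubmodule L
  have hrank := Real.finrank_eq_int_finrank_of_discrete (s := (M : Set E)) (by
    rwa [Submodule.span_eq])
  rw [Set.finrank, Set.finrank, Submodule.span_eq] at hrank
  have hle := Submodule.finrank_le (Submodule.span ℝ (M : Set E))
  have : DiscreteTopology M := ‹_›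
  exact ⟨_, hrank ▸ hle, ⟨(Module.finBasis ℤ M).equivFun.toAddEquiv⟩⟩

theorem IsQuasimorphism.exists_surjective_finite_ker [NormedAddCommGroup E] [NormedSpace ℝ E]
    [FiniteDimensional ℝ E] {f : G → E} {C : ℝ} (hf : IsQuasimorphism f C)
    (hfin : ∀ B : ℝ, {g | ‖f g‖ ≤ B}.Finite) :
    ∃ k ≤ Module.finrank ℝ E, ∃ π : G →* Multiplicative (Fin k → ℤ),
      Function.Surjective π ∧ Finite π.ker := by
  have := hf.finite_commutator hfin
  have := FiniteDimensional.complete ℝ E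
  obtain ⟨B, hB⟩ := ((commutator G : Set G).toFinite.image fun c => ‖f c‖).bddAbove
  obtain ⟨φ, hφ⟩ := hf.exists_addMonoidHom fun c hc => hB (Set.mem_image_of_mem _ hc)
  have hball : {g : G | φ (.ofMul g) ∈ Metric.ball 0 1}.Finite := by
    refine (hfin (C + 1)).subset fun g hg => ?_
    exact (norm_le_norm_add_norm_sub _ _).trans
      ((add_le_add (mem_ball_zero_iff.1 hg).le (hφ g)).trans_eq (add_comm 1 C))
  have : DiscreteTopology φ.range := by
    refine discreteTopology_of_finite_inter_ball one_pos
      ((hball.image fun g => φ (.ofMul g)).subset ?_)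
    rintro _ ⟨⟨g, rfl⟩, hg⟩
    exact ⟨g.toMul, hg, rfl⟩
  obtain ⟨k, hk, ⟨e⟩⟩ := exists_addEquiv_int_of_discreteTopology φ.range
  refine ⟨k, hk, ((e : φ.range →+ (Fin k → ℤ)).comp φ.rangeRestrict).toMultiplicativeRight,
    e.surjective.comp φ.rangeRestrict_surjective, (hball.subset fun g hg => ?_).to_subtype⟩
  have hzero : φ (.ofMul g) = 0 := congrArg Subtype.val ((map_eq_zero_iff e e.injective).1 hg)
  exact hzero ▸ Metric.mem_ball_self one_pos

end Quasimorphism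

section Busemann

variable {X : Type u} {Y : Type v} [PseudoMetricSpace X] [PseudoMetricSpace Y]

/-- The Busemann cocycle `β_x(p, q)` of a sequence `x`, the limit of `d(p, x_n) - d(q, x_n)`.
The limit is taken along a fixed nonprincipal ultrafilter: it then always exists, and the cocycle
identity holds exactly rather than up to a multiple of `δ`. -/
noncomputable def busemann (x : ℕ → X) (p q : X) : ℝ :=
  limUnder (hyperfilter ℕ : Filter ℕ) fun n => dist p (x n) - dist q (x n)

theorem tendsto_busemann (x : ℕ → X) (p q : X) :
    Tendsto (fun n => dist p (x n) - dist q (x n)) (hyperfilter ℕ) (nhds (busemann x p q)) := by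
  obtain ⟨b, -, hb⟩ := (isCompact_Icc (a := -dist p q) (b := dist p q)).ultrafilter_le_nhds'
    ((hyperfilter ℕ).map fun n => dist p (x n) - dist q (x n))
    (Ultrafilter.mem_map.2 <| Eventually.of_forall fun n =>
      abs_le.1 (abs_dist_sub_le p q (x n)))
  exact tendsto_nhds_limUnder ⟨b, hb⟩

theorem busemann_add_busemann (x : ℕ → X) (p q r : X) :
    busemann x p q + busemann x q r = busemann x p r :=
  tendsto_nhds_unique (((tendsto_busemann x p q).add (tendsto_busemann x q r)).congr fun _ =>
    sub_add_sub_cancel _ _ _) (tendsto_busemann x p r)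

theorem busemann_map {g : X → Y} (hg : Isometry g) (x : ℕ → X) (p q : X) :
    busemann (fun n => g (x n)) (g p) (g q) = busemann x p q := by
  simp only [busemann, hg.dist_eq]

end Busemann

section Hyperbolic

variable {X : Type u} [MetricSpace X] {δ : ℝ}

theorem GromovConv.eventually_le {x y : ℕ → X} (h : GromovConv x y) (o : X) (C : ℝ) :
    ∀ᶠ n in atTop, C ≤ gromovProduct (x n) (y n) o :=
  ((h o).comp tendsto_atTop_diagonal).eventually_ge_atTop C

theorem gromovProduct_map {Y : Type v} [MetricSpace Y] {g : X → Y} (hg : Isometry g) (x y o : X) :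
    gromovProduct (g x) (g y) (g o) = gromovProduct x y o := by
  simp only [gromovProduct, hg.dist_eq]

theorem IsHyperbolic.nonneg (h : IsHyperbolic δ X) (o : X) : 0 ≤ δ := by
  simpa [gromovProduct] using h.four_point o o o o

theorem IsHyperbolic.five_point (h : IsHyperbolic δ X) (x y z w o : X) :
    min (min (gromovProduct x y o) (gromovProduct y z o)) (gromovProduct z w o) - 2 * δ ≤
      gromovProduct x w o := by
  have hδ := h.nonneg o
  have hxz := h.four_point x y z o
  have hxw := h.four_point x z w o
  have hmin : min (min (gromovProduct x y o) (gromovProduct y z o)) (gromovProduct z w o) - δ ≤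
      min (gromovProduct x z o) (gromovProduct z w o) :=
    le_min ((sub_le_sub_right (min_le_left _ _) δ).trans hxz)
      ((sub_le_self _ hδ).trans (min_le_right _ _))
  linarith

theorem IsHyperbolic.dist_add_dist_le (h : IsHyperbolic δ X) (x y z w : X) :
    dist x z + dist y w ≤ max (dist x y + dist z w) (dist y z + dist x w) + 2 * δ := by
  have hfour := h.four_point x y z w
  simp only [gromovProduct, dist_comm w, min_def] at hfour
  rw [max_def]
  split_ifs at hfour ⊢ <;> linarith

theorem IsHyperbolic.dist_sub_dist_le (h : IsHyperbolic δ X) {p q x y : X}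
    (hxy : dist p q ≤ gromovProduct x y p) :
    dist p x - dist q x ≤ dist p y - dist q y + 2 * δ := by
  have hfour := h.dist_add_dist_le p q x y
  have htri := dist_triangle p q x
  rw [gromovProduct, dist_comm x p] at hxy
  rw [max_eq_right (by linarith)] at hfour
  linarith

theorem IsHyperbolic.abs_busemann_sub_busemann_le (h : IsHyperbolic δ X) {x y : ℕ → X}
    (hxy : GromovConv x y) (p q : X) : |busemann x p q - busemann y p q| ≤ 2 * δ := by
  refine le_of_tendsto ((tendsto_busemann x p q).sub (tendsto_busemann y p q)).abs
    (Nat.hyperfilter_le_atTop ?_)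
  filter_upwards [hxy.eventually_le p (dist p q)] with n hn
  have hle := h.dist_sub_dist_le hn
  have hge := h.dist_sub_dist_le (gromovProduct_comm (x n) (y n) p ▸ hn)
  exact abs_le.2 ⟨by linarith, by linarith⟩

theorem IsHyperbolic.abs_busemann_map_sub_le (h : IsHyperbolic δ X) {x : ℕ → X} {g : X → X}
    (hg : Isometry g) (hgx : GromovConv (fun n => g (x n)) x) (p q : X) :
    |busemann x (g p) (g q) - busemann x p q| ≤ 2 * δ := by
  rw [← busemann_map hg x p q, abs_sub_comm]
  exact h.abs_busemann_sub_busemann_le hgx _ _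

theorem IsHyperbolic.abs_busemann_map_self_sub_le (h : IsHyperbolic δ X) {x : ℕ → X} {g : X → X}
    (hg : Isometry g) (hgx : GromovConv (fun n => g (x n)) x) (p q : X) :
    |busemann x (g p) p - busemann x (g q) q| ≤ 2 * δ := by
  have hmap := h.abs_busemann_map_sub_le hg hgx p q
  have hleft := busemann_add_busemann x (g p) (g q) q
  have hright := busemann_add_busemann x (g p) p q
  rwa [show busemann x (g p) p - busemann x (g q) q =
    busemann x (g p) (g q) - busemann x p q by linarith]

/-- The point `p` lies `K`-coarsely on a line between the ends of the sequences `x` and `y`. -/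
def IsCoarselyBetween (x y : ℕ → X) (K : ℝ) (p : X) : Prop :=
  ∀ᶠ n in atTop, gromovProduct (x n) (y n) p ≤ K

theorem IsHyperbolic.exists_isCoarselyBetween (h : IsHyperbolic δ X) {x y : ℕ → X}
    (hx : GromovConv x x) (hy : GromovConv y y) (hxy : ¬ GromovConv x y) :
    ∃ K o, IsCoarselyBetween x y K o := by
  contrapose! hxy
  refine gromovConv_iff.2 fun o C => ?_
  obtain ⟨N, hN⟩ := gromovConv_iff.1 hx o (C + 2 * δ)
  obtain ⟨M, hM⟩ := gromovConv_iff.1 hy o (C + 2 * δ)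
  obtain ⟨k, hk, hNk, hMk⟩ := ((not_eventually.1 (hxy (C + 2 * δ) o)).and_eventually
    ((eventually_ge_atTop N).and (eventually_ge_atTop M))).exists
  refine ⟨max N M, fun n hn m hm => (le_sub_iff_add_le.2 ?_).trans
    (h.five_point (x n) (x k) (y k) (y m) o)⟩
  exact le_min (le_min (hN n (le_of_max_le_left hn) k hNk) (not_le.1 hk).le)
    (hM k hMk m (le_of_max_le_right hm))

theorem IsCoarselyBetween.map {x y : ℕ → X} {K : ℝ} {p : X} {g : X → X}
    (hp : IsCoarselyBetween x y K p) (hg : Isometry g) :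
    IsCoarselyBetween (fun n => g (x n)) (fun n => g (y n)) K (g p) :=
  hp.mono fun n hn => (gromovProduct_map hg (x n) (y n) p).trans_le hn

theorem IsHyperbolic.isCoarselyBetween_congr (h : IsHyperbolic δ X) {x y x' y' : ℕ → X} {K : ℝ}
    {p : X} (hp : IsCoarselyBetween x y K p) (hx : GromovConv x x') (hy : GromovConv y' y) :
    IsCoarselyBetween x' y' (K + 2 * δ) p := by
  filter_upwards [hp, hx.eventually_le p (K + 2 * δ + 1), hy.eventually_le p (K + 2 * δ + 1)]
    with n hK hxn hyn
  have hfive := sub_le_iff_le_add.1 ((h.five_point (x n) (x' n) (y' n) (y n) p).trans hK)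
  rcases min_le_iff.1 hfive with hmin | hle
  · exact (min_le_iff.1 hmin).resolve_left (by linarith)
  · linarith

theorem IsHyperbolic.exists_dist_eq_eventually_dist_le (h : IsHyperbolic δ X) {x : ℕ → X}
    (hx : GromovConv x x) (o : X) {R : ℝ} (hR : 0 ≤ R) :
    ∃ p, dist o p = R ∧ ∀ᶠ n in atTop, dist p (x n) ≤ dist o (x n) - R + 2 * δ := by
  obtain ⟨N, hN⟩ := gromovConv_iff.1 hx o R
  have hRN : R ≤ dist o (x N) := (hN N le_rfl N le_rfl).trans (gromovProduct_le_left _ _ _)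
  obtain ⟨γ, hγ₀, hγ₁, hγ⟩ := h.1 o (x N)
  have hop : dist o (γ R) = R := by
    simpa [hγ₀, abs_of_nonneg hR] using hγ 0 ⟨le_rfl, dist_nonneg⟩ R ⟨hR, hRN⟩
  have hpx : dist (γ R) (x N) = dist o (x N) - R := by
    have hdist := hγ R ⟨hR, hRN⟩ _ ⟨dist_nonneg, le_rfl⟩
    rwa [hγ₁, abs_sub_comm, abs_of_nonneg (sub_nonneg.2 hRN)] at hdist
  refine ⟨γ R, hop, eventually_atTop.2 ⟨N, fun n hn => ?_⟩⟩
  have hfour := h.four_point (γ R) (x N) (x n) o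
  have hprod : gromovProduct (γ R) (x N) o = R := by
    rw [gromovProduct, dist_comm _ o, hop, hpx]
    ring
  rw [hprod, min_eq_left (hN N le_rfl n hn), gromovProduct, dist_comm _ o, hop] at hfour
  linarith

theorem IsHyperbolic.exists_dist_eq_isCoarselyBetween (h : IsHyperbolic δ X) {x y : ℕ → X}
    (hx : GromovConv x x) {K : ℝ} {o : X} (ho : IsCoarselyBetween x y K o) {R : ℝ} (hR : 0 ≤ R) :
    ∃ p, dist o p = R ∧ IsCoarselyBetween x y (K + δ) p := by
  obtain ⟨p, hop, hp⟩ := h.exists_dist_eq_eventually_dist_le hx o hR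
  refine ⟨p, hop, ?_⟩
  filter_upwards [ho, hp] with n hK hpx
  have htri := dist_triangle_left p (y n) o
  rw [gromovProduct, dist_comm _ o] at hK
  rw [gromovProduct, dist_comm _ p]
  linarith

theorem IsHyperbolic.dist_le_abs_sub_add (h : IsHyperbolic δ X) {p q x y : X} {K : ℝ}
    (hp : gromovProduct x y p ≤ K) (hq : gromovProduct x y q ≤ K) :
    dist p q ≤ |dist p x - dist q x| + 2 * K + 2 * δ := by
  have hfour := h.dist_add_dist_le p x q y
  have habs := abs_le.1 (le_refl |dist p x - dist q x|)
  rw [gromovProduct, dist_comm x] at hp hq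
  rw [dist_comm x q] at hfour
  rcases le_max_iff.1 (sub_le_iff_le_add.2 hfour) with hle | hle <;> linarith

theorem IsHyperbolic.dist_le_abs_busemann_add (h : IsHyperbolic δ X) {x y : ℕ → X} {p q : X}
    {K : ℝ} (hp : IsCoarselyBetween x y K p) (hq : IsCoarselyBetween x y K q) :
    dist p q ≤ |busemann x p q| + 2 * K + 2 * δ :=
  ge_of_tendsto (((tendsto_busemann x p q).abs.add_const _).add_const _)
    (Nat.hyperfilter_le_atTop (hp.and hq |>.mono fun _ hpq => h.dist_le_abs_sub_add hpq.1 hpq.2))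

theorem IsHyperbolic.dist_map_self_le (h : IsHyperbolic δ X) {x y : ℕ → X} {g : X → X}
    (hg : Isometry g) (hgx : GromovConv (fun n => g (x n)) x)
    (hgy : GromovConv y (fun n => g (y n))) {p : X} {K : ℝ} (hp : IsCoarselyBetween x y K p)
    (o : X) : dist (g p) p ≤ |busemann x (g o) o| + 2 * K + 8 * δ := by
  have hδ := h.nonneg o
  have hgp := h.isCoarselyBetween_congr (hp.map hg) hgx hgy
  have hdist := h.dist_le_abs_busemann_add hgp (hp.mono fun n hn => hn.trans (by linarith))
  have hshift := (abs_sub_abs_le_abs_sub _ _).trans (h.abs_busemann_map_self_sub_le hg hgx p o)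
  linarith

instance : MulAction (X ≃ᵢ X) (GromovBoundary X) where
  smul := GromovBoundary.map
  one_smul := by rintro ⟨x⟩; rfl
  mul_smul := by rintro g k ⟨x⟩; rfl

theorem IsHyperbolic.gromovConv_of_smul_eq (h : IsHyperbolic δ X) {x : GromovSeq X}
    {ξ : GromovBoundary X} (hx : Quot.mk _ x = ξ) {g : X ≃ᵢ X} (hg : g • ξ = ξ) :
    GromovConv (fun n => g (x.1 n)) x.1 := by
  subst hx
  exact (GromovBoundary.mk_eq_mk_iff h (x.map g) x).1 hg

theorem IsHyperbolic.isQuasimorphism_busemann (h : IsHyperbolic δ X) {G : Type v} [Group G]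
    (α : G →* (X ≃ᵢ X)) {x : ℕ → X} (hx : ∀ g, GromovConv (fun n => α g (x n)) x) (o : X) :
    IsQuasimorphism (fun g => busemann x (α g o) o) (2 * δ) := fun g k => by
  simp only [map_mul, IsometryEquiv.mul_apply]
  rw [← busemann_add_busemann x (α g (α k o)) (α g o) o, add_sub_cancel_right]
  exact h.abs_busemann_map_sub_le (α g).isometry (hx g) (α k o) o

theorem IsHyperbolic.exists_quasimorphism (h : IsHyperbolic δ X) {ξ η : GromovBoundary X}
    (hne : ξ ≠ η) : ∃ f : fixingSubgroup (X ≃ᵢ X) {ξ, η} → ℝ, IsQuasimorphism f (2 * δ) ∧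
      ∃ (C : ℝ) (o : X), ∀ R, ∃ p, R ≤ dist o p ∧ ∀ g : fixingSubgroup (X ≃ᵢ X) {ξ, η},
        dist (g.1 o) o ≤ |f g| + C ∧ dist (g.1 p) p ≤ |f g| + C := by
  obtain ⟨x, hx⟩ := Quot.exists_rep ξ
  obtain ⟨y, hy⟩ := Quot.exists_rep η
  have hgx (g : fixingSubgroup (X ≃ᵢ X) {ξ, η}) : GromovConv (fun n => g.1 (x.1 n)) x.1 :=
    h.gromovConv_of_smul_eq hx ((mem_fixingSubgroup_iff _).1 g.2 ξ (by simp))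
  have hgy (g : fixingSubgroup (X ≃ᵢ X) {ξ, η}) : GromovConv y.1 (fun n => g.1 (y.1 n)) :=
    (GromovSeq.Equivalent.equivalence h).symm (x := y.map g.1) (y := y) <|
      h.gromovConv_of_smul_eq hy ((mem_fixingSubgroup_iff _).1 g.2 η (by simp))
  have hxy : ¬ GromovConv x.1 y.1 := fun hxy =>
    hne (hx.symm.trans (((GromovBoundary.mk_eq_mk_iff h x y).2 hxy).trans hy))
  obtain ⟨K, o, ho⟩ := h.exists_isCoarselyBetween x.2 y.2 hxy
  have hδ := h.nonneg o
  refine ⟨_, h.isQuasimorphism_busemann (Subgroup.subtype _) hgx o, 2 * K + 10 * δ, o,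
    fun R => ?_⟩
  obtain ⟨p, hop, hp⟩ := h.exists_dist_eq_isCoarselyBetween x.2 ho (le_max_right R 0)
  have hmove (g : fixingSubgroup (X ≃ᵢ X) {ξ, η}) {q : X} {K : ℝ}
      (hq : IsCoarselyBetween x.1 y.1 K q) :=
    h.dist_map_self_le g.1.isometry (hgx g) (hgy g) hq o
  exact ⟨p, hop.ge.trans' (le_max_left R 0), fun g =>
    ⟨(hmove g ho).trans (by linarith!), (hmove g hp).trans (by linarith!)⟩⟩

end Hyperbolic

section GroupAction

variable {G : Type u} [Group G]

theorem isFiniteRelIndex_fixingSubgroup_stabilizer {Y : Type v} [MulAction G Y] {s : Set Y}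
    (hs : s.Finite) : (fixingSubgroup G s).IsFiniteRelIndex (MulAction.stabilizer G s) := by
  have := hs.to_subtype
  have hker : (MulAction.toPermHom (MulAction.stabilizer G s) s).ker ≤
      (fixingSubgroup G s).subgroupOf (MulAction.stabilizer G s) := fun g hg =>
    (mem_fixingSubgroup_iff G).2 fun y hy => congrArg Subtype.val (Equiv.ext_iff.1 hg ⟨y, hy⟩)
  exact Subgroup.isFiniteRelIndex_iff_finiteIndex.2 (Subgroup.finiteIndex_of_le hker)

theorem IsAUAcylindrical.comp {Y : Type w} [MetricSpace Y] {H : Type v} [Group H]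
    {ρ : G →* (Y ≃ᵢ Y)} (hρ : IsAUAcylindrical ρ) {φ : H →* G} (hφ : Function.Injective φ) :
    IsAUAcylindrical (ρ.comp φ) := fun ε hε =>
  (hρ ε hε).imp fun _ hR => ⟨hR.1, fun x y hxy => (hR.2 x y hxy).preimage hφ.injOn⟩

theorem VirtuallyIsomorphic.of_surjective {Q : Type v} [Group Q] {H : Subgroup G} [H.FiniteIndex]
    {π : H →* Q} (hπ : Function.Surjective π) [Finite π.ker] : VirtuallyIsomorphic G Q :=
  ⟨H, ⊤, inferInstance, inferInstance, π.ker, ⊥, inferInstance, inferInstance, inferInstance,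
    inferInstance, ⟨(QuotientGroup.quotientKerEquivOfSurjective π hπ).trans
      (QuotientGroup.quotientBot.trans Subgroup.topEquiv).symm⟩⟩

end GroupAction

section Product

variable {ι : Type v} [Fintype ι] [Nonempty ι] {X : ι → Type u} [∀ i, MetricSpace (X i)] {δ : ℝ}
  {ξ η : ∀ i, GromovBoundary (X i)} {G : Type w} [Group G]
  {ρ : G →* ((∀ i, X i) ≃ᵢ (∀ i, X i))}
  {τ : ∀ i, G →* fixingSubgroup (X i ≃ᵢ X i) {ξ i, η i}}

theorem IsAUAcylindrical.exists_proper_quasimorphism (hρ : IsAUAcylindrical ρ)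
    (hX : ∀ i, IsHyperbolic δ (X i)) (hτ : ∀ g z i, ρ g z i = (τ i g).1 (z i))
    (hξη : ∀ i, ξ i ≠ η i) :
    ∃ f : G → ι → ℝ, IsQuasimorphism f (2 * δ) ∧ ∀ B : ℝ, {g | ‖f g‖ ≤ B}.Finite := by
  choose f hf C o hline using fun i => (hX i).exists_quasimorphism (hξη i)
  refine ⟨_, .pi fun i => (hf i).comp (τ i), fun B => ?_⟩
  obtain ⟨C', hC'⟩ := Finite.exists_le C
  set ε := max (B + C') 1
  have hε : 0 < ε := lt_max_of_lt_right one_pos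
  obtain ⟨R, -, hR⟩ := hρ ε hε
  choose p hop hmove using fun i => hline i R
  have hfar : R ≤ dist o p := (hop (Classical.arbitrary ι)).trans (dist_le_pi_dist o p _)
  refine (hR o p hfar).subset fun g hg => ?_
  have hle (i : ι) : |f i (τ i g)| + C i ≤ ε :=
    (add_le_add ((norm_le_pi_norm _ i).trans hg) (hC' i)).trans (le_max_left _ _)
  rintro z (rfl | rfl) <;> refine (dist_pi_le_iff hε.le).2 fun i => ?_ <;> rw [hτ]
  · exact (hmove i (τ i g)).1.trans (hle i)
  · exact (hmove i (τ i g)).2.trans (hle i)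

theorem IsAUAcylindrical.exists_surjective_finite_ker (hρ : IsAUAcylindrical ρ)
    (hX : ∀ i, IsHyperbolic δ (X i)) (hτ : ∀ g z i, ρ g z i = (τ i g).1 (z i))
    (hξη : ∀ i, ξ i ≠ η i) :
    ∃ k ≤ Fintype.card ι, ∃ π : G →* Multiplicative (Fin k → ℤ),
      Function.Surjective π ∧ Finite π.ker := by
  obtain ⟨f, hf, hproper⟩ := hρ.exists_proper_quasimorphism hX hτ hξη
  simpa only [Module.finrank_fintype_fun_eq_card] using hf.exists_surjective_finite_ker hproper

end Product

namespace ProdAut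

variable {D : ℕ} {X : Fin D → Type u} [∀ i, MetricSpace (X i)]

/-- The permutation of the factors as a homomorphism to `Equiv.Perm (Fin D)`. The inverse is needed
because `ProdAut.perm` reverses products. -/
def permHom (X : Fin D → Type u) [∀ i, MetricSpace (X i)] : ProdAut X →* Equiv.Perm (Fin D) where
  toFun g := g.perm⁻¹
  map_one' := inv_one
  map_mul' g h := mul_inv_rev h.perm g.perm

/-- The automorphisms which permute no factors and fix both boundary points `ξ` and `η`. -/
def pureFixator (ξ η : RegBoundary X) : Subgroup (ProdAut X) :=
  (permHom X).ker ⊓ fixingSubgroup (ProdAut X) {ξ, η}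

theorem isFiniteRelIndex_pureFixator_stabilizer (ξ η : RegBoundary X) :
    (pureFixator ξ η).IsFiniteRelIndex
      (MulAction.stabilizer (ProdAut X) ({ξ, η} : Set (RegBoundary X))) := by
  have := isFiniteRelIndex_fixingSubgroup_stabilizer (G := ProdAut X)
    (Set.toFinite ({ξ, η} : Set (RegBoundary X)))
  have : (permHom X).ker.IsFiniteRelIndex
      (MulAction.stabilizer (ProdAut X) ({ξ, η} : Set (RegBoundary X))) :=
    Subgroup.isFiniteRelIndex_of_finiteIndex
  exact ⟨Subgroup.relIndex_inf_ne_zero Subgroup.relIndex_ne_zero Subgroup.relIndex_ne_zero⟩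

variable {ξ η : RegBoundary X}

theorem perm_eq_one_of_mem_pureFixator {g : ProdAut X} (hg : g ∈ pureFixator ξ η) : g.perm = 1 :=
  inv_eq_one.1 hg.1

/-- The isometry of the factor `X j` induced by an automorphism which permutes no factors. -/
noncomputable def factor (g : ProdAut X) (hg : g.perm = 1) (j : Fin D) : X j ≃ᵢ X j :=
  (castIso X (by rw [hg]; rfl : j = g.perm j)).trans (g.iso j)

theorem smul_apply_eq_factor (g : ProdAut X) (hg : g.perm = 1) (z : ∀ i, X i) (j : Fin D) :
    (g • z) j = g.factor hg j (z j) := by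
  obtain ⟨σ, φ⟩ := g
  obtain rfl : σ = 1 := hg
  rfl

theorem regBoundary_smul_apply_eq_factor (g : ProdAut X) (hg : g.perm = 1) (ξ : RegBoundary X)
    (j : Fin D) : (g • ξ) j = g.factor hg j • ξ j := by
  obtain ⟨σ, φ⟩ := g
  obtain rfl : σ = 1 := hg
  rfl

/-- The isometries induced on the factor `X j`, as a homomorphism into the isometries fixing the
`j`-th coordinates of both boundary points. -/
noncomputable def factorHom (ξ η : RegBoundary X) (j : Fin D) :
    pureFixator ξ η →* fixingSubgroup (X j ≃ᵢ X j) {ξ j, η j} where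
  toFun g := ⟨g.1.factor (perm_eq_one_of_mem_pureFixator g.2) j,
    (mem_fixingSubgroup_iff _).2 <| by
      have hfix := (mem_fixingSubgroup_iff _).1 g.2.2
      rintro z (rfl | rfl)
      · exact (regBoundary_smul_apply_eq_factor _ _ ξ j).symm.trans
          (congrFun (hfix ξ (Set.mem_insert _ _)) j)
      · exact (regBoundary_smul_apply_eq_factor _ _ η j).symm.trans
          (congrFun (hfix η (Set.mem_insert_of_mem _ rfl)) j)⟩
  map_one' := rfl
  map_mul' := by
    rintro ⟨⟨σ, φ⟩, hg⟩ ⟨⟨σ', φ'⟩, hg'⟩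
    obtain rfl : σ = 1 := perm_eq_one_of_mem_pureFixator hg
    obtain rfl : σ' = 1 := perm_eq_one_of_mem_pureFixator hg'
    rfl

end ProdAut

end HypProd

/-- For an AU-acylindrical action of `Γ` on a product `𝕏` of `D ≥ 1` geodesic `δ`-hyperbolic
spaces and two regular boundary points with distinct factors, the stabilizer in `Γ` of the pair
is virtually isomorphic to `ℤ^k` for some `0 ≤ k ≤ D`. -/
theorem mainTheorem4 {D : ℕ} (hD : 1 ≤ D) (X : Fin D → Type*)
    [∀ i, MetricSpace (X i)] (δ : ℝ) (hX : ∀ i, HypProd.IsHyperbolic δ (X i))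
    (Γ : Type*) [Group Γ] (ρ : Γ →* HypProd.ProdAut X)
    (hρ : HypProd.IsAUAcylindrical ((HypProd.toIsom (HypProd.ProdAut X) (∀ i, X i)).comp ρ))
    (ξm ξp : HypProd.RegBoundary X) (hξ : ∀ i, ξm i ≠ ξp i) :
    ∃ k : ℕ, k ≤ D ∧
      HypProd.VirtuallyIsomorphic
        ((MulAction.stabilizer (HypProd.ProdAut X)
          ({ξm, ξp} : Set (HypProd.RegBoundary X))).comap ρ)
        (Multiplicative (Fin k → ℤ)) := by
  have : Nonempty (Fin D) := Fin.pos_iff_nonempty.1 hD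
  let S := MulAction.stabilizer (HypProd.ProdAut X) ({ξm, ξp} : Set (HypProd.RegBoundary X))
  let P := HypProd.ProdAut.pureFixator ξm ξp
  let H : Subgroup (S.comap ρ) := (P.comap ρ).subgroupOf (S.comap ρ)
  let φ : H →* Γ := (S.comap ρ).subtype.comp H.subtype
  let ψ : H →* P := (ρ.comp φ).codRestrict P fun g => g.2
  have : H.FiniteIndex := ⟨Subgroup.relIndex_comap_ne_zero _
    (HypProd.ProdAut.isFiniteRelIndex_pureFixator_stabilizer ξm ξp).relIndex_ne_zero⟩
  have hφ : Function.Injective φ := Subtype.val_injective.comp Subtype.val_injective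
  obtain ⟨k, hk, π, hπ, hker⟩ := (hρ.comp hφ).exists_surjective_finite_ker
    (τ := fun i => (HypProd.ProdAut.factorHom ξm ξp i).comp ψ) hX
    (fun g => HypProd.ProdAut.smul_apply_eq_factor _
      (HypProd.ProdAut.perm_eq_one_of_mem_pureFixator (ψ g).2)) hξ
  exact ⟨k, hk.trans_eq (Fintype.card_fin D), .of_surjective hπ⟩
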